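/- Let $N$ be a natural number and let $G$ be a compact subgroup of $\mathrm{U}(N)$, acting linearly on $\mathbb{C}^N$ in the natural way. Equip $\mathbb{C}^N$ with its standard symplectic form $\omega=\sum_{k} dx_k\wedge dy_k$, where $z_k=x_k+iy_k$. Suppose that this action is coisotropic, that is, that every principal $G$-orbit $W\subset\mathbb{C}^N$ satisfies $(T_pW)^{\perp_\omega}\subseteq T_pW$ for all $p\in W$. (An orbit $Gp$ is principal if for every $q\in\mathbb{C}^N$ the isotropy group $G_p$ is conjugate in $G$ to a subgroup of $G_q$.) Then the real $G$-module $\mathbb{C}^N\simeq\mathbb{R}^{2N}$ does not contain two distinct equivalent $G$-submodules: if $E_1,E_2\subseteq\mathbb{C}^N$ are $G$-invariant real linear subspaces for which there is a $G$-equivariant real-linear isomorphism $E_1\to E_2$, then $E_1=E_2$. -/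

import Mathlib

open scoped ContDiff

noncomputable section

/-- The velocities at `p` of the smooth curves `ℝ → E` that stay in `W` and pass through `p` at
time `0`. If `W` is an embedded submanifold of `E`, this is the tangent space `T_p W ⊆ E`. -/
def tangentVectors {E : Type*} [NormedAddCommGroup E] [NormedSpace ℝ E] (W : Set E) (p : E) :
    Set E :=
  {v | ∃ γ : ℝ → E, ContDiff ℝ ∞ γ ∧ (∀ t, γ t ∈ W) ∧ γ 0 = p ∧ HasDerivAt γ v 0}

/-- The standard symplectic form `∑ₖ dxₖ ∧ dyₖ` on `ℂ^N`, where `zₖ = xₖ + i yₖ`. -/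
def stdSymplecticForm {N : ℕ} (u v : EuclideanSpace ℂ (Fin N)) : ℝ :=
  ∑ k, ((u k).re * (v k).im - (u k).im * (v k).re)

/-- The symplectic orthogonal complement of a set of vectors in `ℂ^N`. -/
def symplecticPerp {N : ℕ} (T : Set (EuclideanSpace ℂ (Fin N))) :
    Set (EuclideanSpace ℂ (Fin N)) :=
  {u | ∀ v ∈ T, stdSymplecticForm u v = 0}

/-- A submanifold `W` of `ℂ^N` is coisotropic if `(T_p W)^⊥ω ⊆ T_p W` for all `p ∈ W`. -/
def IsCoisotropicSubmanifold {N : ℕ} (W : Set (EuclideanSpace ℂ (Fin N))) : Prop :=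
  ∀ p ∈ W, symplecticPerp (tangentVectors W p) ⊆ tangentVectors W p

/-- The real `G`-module `ℂ^N ≃ ℝ^{2N}`: the natural action of a subgroup `G` of `U(N)` on `ℂ^N`
by matrix multiplication, as a representation over `ℝ`. -/
def realModule {N : ℕ} (G : Subgroup (Matrix.unitaryGroup (Fin N) ℂ)) :
    Representation ℝ G (EuclideanSpace ℂ (Fin N)) where
  toFun g := (Matrix.toEuclideanLin (g : Matrix (Fin N) (Fin N) ℂ)).restrictScalars ℝ
  map_one' := by
    ext v i
    simp
  map_mul' g h := by
    ext v i
    simp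

theorem realModule_apply {N : ℕ} (G : Subgroup (Matrix.unitaryGroup (Fin N) ℂ)) (g : G)
    (v : EuclideanSpace ℂ (Fin N)) (i : Fin N) :
    realModule G g v i = ∑ j, (g : Matrix (Fin N) (Fin N) ℂ) i j * v j := rfl

/-- The orbit `G p`. -/
def orbitOf {N : ℕ} (G : Subgroup (Matrix.unitaryGroup (Fin N) ℂ))
    (p : EuclideanSpace ℂ (Fin N)) : Set (EuclideanSpace ℂ (Fin N)) :=
  Set.range fun g : G => realModule G g p

/-- The isotropy subgroup `G_p`. -/
def isotropy {N : ℕ} (G : Subgroup (Matrix.unitaryGroup (Fin N) ℂ))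
    (p : EuclideanSpace ℂ (Fin N)) : Subgroup G where
  carrier := {g | realModule G g p = p}
  one_mem' := by simp
  mul_mem' {g h} hg hh := by
    simp only [Set.mem_ofPred_eq] at hg hh ⊢
    rw [map_mul, Module.End.mul_apply, hh, hg]
  inv_mem' {g} hg := by
    simp only [Set.mem_ofPred_eq] at hg ⊢
    conv_lhs => rw [← hg]
    rw [← Module.End.mul_apply, ← map_mul, inv_mul_cancel, map_one, Module.End.one_apply]

/-- The orbit of `p` is principal (of maximal orbit type): the isotropy group `G_p` is conjugate
in `G` to a subgroup of every other isotropy group `G_q`. -/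
def IsPrincipalPoint {N : ℕ} (G : Subgroup (Matrix.unitaryGroup (Fin N) ℂ))
    (p : EuclideanSpace ℂ (Fin N)) : Prop :=
  ∀ q : EuclideanSpace ℂ (Fin N), ∃ g : G, ∀ h ∈ isotropy G p, g * h * g⁻¹ ∈ isotropy G q

/-- The action of `G` on `ℂ^N` is coisotropic: all principal orbits are coisotropic
with respect to the standard symplectic form. -/
def IsCoisotropicAction {N : ℕ} (G : Subgroup (Matrix.unitaryGroup (Fin N) ℂ)) : Prop :=
  ∀ p : EuclideanSpace ℂ (Fin N), IsPrincipalPoint G p → IsCoisotropicSubmanifold (orbitOf G p)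

end

/-! For a symmetric equivariant `A`, the invariant quadratic form `⟪A x, x⟫` has gradient `2 A p`,
orthogonal to the orbit of `p`. At a principal point coisotropy makes `i A p` tangent, hence
orthogonal to `B p` for any other such `B`. Principal points are dense because `G` is compact
(`dense_isPrincipalPoint`), so `⟪B p, i A p⟫ = 0` everywhere. Polarising gives `B i A = A i B`, and
`A = id` then shows that `B` commutes with `i`; so all such `A`, `B` commute (`apply_apply_comm`).

Distinct equivalent submodules would break this commutativity: orthogonal projections and the
symmetrised intertwiner are symmetric and equivariant (`le_of_equivariant_of_commute`). -/

open scoped InnerProductSpace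

/-! ### Orthogonal representations: density of minimal isotropy, and commuting symmetric
endomorphisms -/

section OrthogonalRepresentation

variable {G V : Type*} [Group G] [NormedAddCommGroup V] [InnerProductSpace ℝ V]
  {ρ : Representation ℝ G V}

theorem inner_representation_left (hρ : ∀ g u v, ⟪ρ g u, ρ g v⟫_ℝ = ⟪u, v⟫_ℝ) (g : G) (u v : V) :
    ⟪ρ g u, v⟫_ℝ = ⟪u, ρ g⁻¹ v⟫_ℝ := by
  rw [← hρ g u, ρ.self_inv_apply]

/-- If the pairing of `p` with the orbit of `q` is maximal at `q`, then the isotropy group of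
`p + q` is contained in those of `p` and `q`. -/
theorem fixes_of_fixes_add (hρ : ∀ g u v, ⟪ρ g u, ρ g v⟫_ℝ = ⟪u, v⟫_ℝ) {p q : V}
    (hpq : ∀ g, ⟪p, ρ g q⟫_ℝ ≤ ⟪p, q⟫_ℝ) {g : G} (hg : ρ g (p + q) = p + q) :
    ρ g p = p ∧ ρ g q = q := by
  have hq := real_inner_self_nonneg (x := ρ g q - q)
  have h₁ := hpq g
  have h₂ := hpq g⁻¹
  rw [← inner_representation_left hρ] at h₂
  have h₃ : ⟪ρ g p + ρ g q, p + q⟫_ℝ = ⟪p + q, p + q⟫_ℝ := by rw [← map_add, hg]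
  have hp : ⟪ρ g p - p, ρ g p - p⟫_ℝ = 0 := by
    refine le_antisymm ?_ real_inner_self_nonneg
    -- Expanding `h₃` and bounding its other three terms by `h₁`, `h₂`, `hq` leaves `⟪ρ g p, p⟫ ≥
    -- ⟪p, p⟫`.
    simp only [inner_add_left, inner_add_right, inner_sub_left, inner_sub_right, hρ] at *
    linarith [real_inner_comm p (ρ g p), real_inner_comm p (ρ g q), real_inner_comm q (ρ g q),
      real_inner_comm p q]
  have : ρ g p = p := sub_eq_zero.1 (inner_self_eq_zero.1 hp)
  refine ⟨this, ?_⟩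
  rw [map_add, this] at hg
  exact add_left_cancel hg

/-- The vectors that are fixed by the isotropy group of `p`. -/
def isotropyFixed (ρ : Representation ℝ G V) (p : V) : Submodule ℝ V where
  carrier := {v | ∀ g, ρ g p = p → ρ g v = v}
  add_mem' hu hv g hg := by rw [map_add, hu g hg, hv g hg]
  zero_mem' g _ := map_zero _
  smul_mem' c v hv g hg := by rw [map_smul, hv g hg]

/-- Some isotropy group is minimal among all isotropy groups. -/
theorem exists_minimal_isotropy [FiniteDimensional ℝ V] (ρ : Representation ℝ G V) :
    ∃ p : V, ∀ q, (∀ g, ρ g q = q → ρ g p = p) → ∀ g, ρ g p = p → ρ g q = q := by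
  -- Smaller isotropy fixes more vectors, so `p` is chosen with a maximal fixed subspace.
  obtain ⟨_, ⟨p, rfl⟩, hp⟩ := (wellFounded_gt (α := Submodule ℝ V)).has_min
    (Set.range (isotropyFixed ρ)) (Set.range_nonempty _)
  refine ⟨p, fun q hq g hg => ?_⟩
  have hle : isotropyFixed ρ p ≤ isotropyFixed ρ q := fun v hv g hg => hv g (hq g hg)
  have heq : isotropyFixed ρ p = isotropyFixed ρ q :=
    hle.eq_of_not_lt (hp _ ⟨q, rfl⟩)
  have hqq : q ∈ isotropyFixed ρ q := fun _ h => h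
  rw [← heq] at hqq
  exact hqq g hg

/-- For an orthogonal representation whose orbits attain their maximal pairing with every vector,
the points whose isotropy group is conjugate to a subgroup of every isotropy group are dense. -/
theorem dense_subconjugate_isotropy [FiniteDimensional ℝ V]
    (hρ : ∀ g u v, ⟪ρ g u, ρ g v⟫_ℝ = ⟪u, v⟫_ℝ)
    (hmax : ∀ p q, ∃ g, ∀ h, ⟪p, ρ h q⟫_ℝ ≤ ⟪p, ρ g q⟫_ℝ) :
    Dense {p : V | ∀ q, ∃ g, ∀ h, ρ h p = p → ρ (g * h * g⁻¹) q = q} := by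
  have hmove : ∀ p q, ∃ g, ∀ h, ⟪p, ρ h (ρ g q)⟫_ℝ ≤ ⟪p, ρ g q⟫_ℝ := fun p q => by
    obtain ⟨g, hg⟩ := hmax p q
    exact ⟨g, fun h => by rw [← Module.End.mul_apply, ← map_mul]; exact hg _⟩
  obtain ⟨p, hp⟩ := exists_minimal_isotropy ρ
  have key : ∀ q, ∃ g, ∀ h, ρ h p = p → ρ (g * h * g⁻¹) q = q := fun q => by
    obtain ⟨g, hg⟩ := hmove p q
    refine ⟨g⁻¹, fun h hh => ?_⟩
    have h₁ := hp (p + ρ g q) (fun k hk => (fixes_of_fixes_add hρ hg hk).1) h hh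
    have h₂ := (fixes_of_fixes_add hρ hg h₁).2
    rw [map_mul, map_mul, Module.End.mul_apply, Module.End.mul_apply, inv_inv, h₂,
      ρ.inv_self_apply]
  intro x
  obtain ⟨k, hk⟩ := hmove x p
  -- A small push from `x` towards a suitable translate of `p` shrinks the isotropy into that of the
  -- translate, a conjugate of the minimal one.
  have hε : ∀ ε : ℝ, 0 < ε →
      x + ε • ρ k p ∈ {p : V | ∀ q, ∃ g, ∀ h, ρ h p = p → ρ (g * h * g⁻¹) q = q} := by
    intro ε hε q
    obtain ⟨g, hg⟩ := key q
    refine ⟨g * k⁻¹, fun h hh => ?_⟩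
    have h₁ := (fixes_of_fixes_add hρ (p := x) (q := ε • ρ k p) (fun h => by
      rw [map_smul, inner_smul_right, inner_smul_right]
      exact mul_le_mul_of_nonneg_left (hk h) hε.le) hh).2
    rw [map_smul] at h₁
    have h₂ : ρ h (ρ k p) = ρ k p := smul_right_injective V hε.ne' h₁
    have h₃ := hg (k⁻¹ * h * k) (by
      rw [map_mul, map_mul, Module.End.mul_apply, Module.End.mul_apply, h₂, ρ.inv_self_apply])
    simpa [mul_assoc] using h₃
  have hlim : Filter.Tendsto (fun ε : ℝ => x + ε • ρ k p) (nhdsWithin 0 (Set.Ioi 0)) (nhds x) := by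
    have : ContinuousAt (fun ε : ℝ => x + ε • ρ k p) 0 := by fun_prop
    simpa [ContinuousAt] using this.mono_left nhdsWithin_le_nhds
  exact mem_closure_of_tendsto hlim (eventually_mem_nhdsWithin.mono fun ε h => hε ε h)

theorem starProjection_representation [FiniteDimensional ℝ V]
    (hρ : ∀ g u v, ⟪ρ g u, ρ g v⟫_ℝ = ⟪u, v⟫_ℝ) (E : Submodule ℝ V)
    (hE : ∀ g, ∀ v ∈ E, ρ g v ∈ E) (g : G) (v : V) :
    E.starProjection (ρ g v) = ρ g (E.starProjection v) := by
  refine (Submodule.eq_starProjection_of_mem_orthogonal (hE g _ (E.starProjection_apply_mem v))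
    fun u hu => ?_)
  rw [← map_sub, real_inner_comm, inner_representation_left hρ, real_inner_comm]
  exact E.sub_starProjection_mem_orthogonal v _ (hE _ _ hu)

theorem adjoint_representation [FiniteDimensional ℝ V]
    (hρ : ∀ g u v, ⟪ρ g u, ρ g v⟫_ℝ = ⟪u, v⟫_ℝ) {S : V →ₗ[ℝ] V}
    (hS : ∀ g v, S (ρ g v) = ρ g (S v)) (g : G) (v : V) :
    S.adjoint (ρ g v) = ρ g (S.adjoint v) := by
  refine ext_inner_right ℝ fun w => ?_
  rw [LinearMap.adjoint_inner_left, inner_representation_left hρ, inner_representation_left hρ,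
    LinearMap.adjoint_inner_left, hS]

/-- If all symmetric equivariant endomorphisms commute, then equivalent invariant subspaces are
contained in each other. -/
theorem le_of_equivariant_of_commute [FiniteDimensional ℝ V]
    (hρ : ∀ g u v, ⟪ρ g u, ρ g v⟫_ℝ = ⟪u, v⟫_ℝ)
    (hcomm : ∀ A B : V →ₗ[ℝ] V, A.IsSymmetric → B.IsSymmetric →
      (∀ g v, A (ρ g v) = ρ g (A v)) → (∀ g v, B (ρ g v) = ρ g (B v)) →
      ∀ v, A (B v) = B (A v))
    {E F : Submodule ℝ V} (hE : ∀ g, ∀ v ∈ E, ρ g v ∈ E) (hF : ∀ g, ∀ v ∈ F, ρ g v ∈ F)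
    (T : E →ₗ[ℝ] F) (hTinj : Function.Injective T)
    (hT : ∀ g (v : E), (T ⟨ρ g v, hE g v v.2⟩ : V) = ρ g (T v)) : E ≤ F := by
  intro v hv
  have hPE := starProjection_representation hρ E hE
  have hPF := starProjection_representation hρ F hF
  have hsE : (E.starProjection : V →ₗ[ℝ] V).IsSymmetric := E.starProjection_isSymmetric
  have hsF : (F.starProjection : V →ₗ[ℝ] V).IsSymmetric := F.starProjection_isSymmetric
  have hEF : E.starProjection (F.starProjection v) = F.starProjection (E.starProjection v) :=
    hcomm _ _ hsE hsF hPE hPF v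
  rw [E.starProjection_eq_self_iff.2 hv] at hEF
  set w := v - F.starProjection v with hw
  have hwE : w ∈ E := E.sub_mem hv (E.starProjection_eq_self_iff.1 hEF)
  have hwF : w ∈ Fᗮ := F.sub_starProjection_mem_orthogonal v
  -- `T` extended by zero on `Eᗮ`. Since `w ⊥ F`, `S.adjoint` kills `w`, and commuting `S +
  -- S.adjoint` with the projection to `F` at `w` gives `T w = 0`.
  let S : V →ₗ[ℝ] V := F.subtype ∘ₗ T ∘ₗ (E.orthogonalProjectionOnto : V →ₗ[ℝ] E)
  have hS : ∀ g v, S (ρ g v) = ρ g (S v) := fun g v => by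
    change (T (E.orthogonalProjectionOnto (ρ g v)) : V) = ρ g (T (E.orthogonalProjectionOnto v))
    rw [← hT]
    congr 2
    exact Subtype.ext (hPE g v)
  have hSw : S w = T ⟨w, hwE⟩ := by
    change (T (E.orthogonalProjectionOnto w) : V) = _
    congr 2
    exact Subtype.ext (E.starProjection_eq_self_iff.2 hwE)
  have hS'w : S.adjoint w = 0 := by
    refine ext_inner_right ℝ fun u => ?_
    rw [LinearMap.adjoint_inner_left, inner_zero_left, real_inner_comm]
    exact hwF _ (Subtype.property _)
  have hA : (S + S.adjoint).IsSymmetric := fun x y => by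
    simp only [LinearMap.add_apply, inner_add_left, inner_add_right, LinearMap.adjoint_inner_left,
      LinearMap.adjoint_inner_right]
    exact add_comm _ _
  have h := hcomm (S + S.adjoint) F.starProjection hA hsF
    (fun g v => by simp only [LinearMap.add_apply, hS, adjoint_representation hρ hS, map_add])
    hPF w
  have hFw : F.starProjection w = 0 := F.starProjection_apply_eq_zero_iff.2 hwF
  simp only [ContinuousLinearMap.coe_coe, hFw, map_zero, LinearMap.add_apply, hS'w, add_zero,
    hSw, F.starProjection_eq_self_iff.2 (T ⟨w, hwE⟩).2] at h
  have hT0 : (⟨w, hwE⟩ : E) = 0 := hTinj (by rw [map_zero]; exact Subtype.ext h.symm)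
  have hw0 : v - F.starProjection v = 0 := congrArg Subtype.val hT0
  rw [sub_eq_zero.1 hw0]
  exact F.starProjection_apply_mem v

end OrthogonalRepresentation

/-! ### Invariant quadratic forms of a coisotropic action -/

section Unitary

variable {N : ℕ} {G : Subgroup (Matrix.unitaryGroup (Fin N) ℂ)}

theorem real_inner_euclideanSpace (u v : EuclideanSpace ℂ (Fin N)) :
    ⟪u, v⟫_ℝ = ∑ k, ((u k).re * (v k).re + (u k).im * (v k).im) := by
  rw [PiLp.inner_apply]
  refine Finset.sum_congr rfl fun k _ => ?_
  rw [Complex.inner]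
  simp
  ring

theorem real_inner_euclideanSpace_eq_re (u v : EuclideanSpace ℂ (Fin N)) :
    ⟪u, v⟫_ℝ = (inner ℂ u v).re := by
  rw [real_inner_euclideanSpace, PiLp.inner_apply, Complex.re_sum]
  refine Finset.sum_congr rfl fun k _ => ?_
  simp
  ring

theorem stdSymplecticForm_eq_inner (u v : EuclideanSpace ℂ (Fin N)) :
    stdSymplecticForm u v = ⟪Complex.I • u, v⟫_ℝ := by
  rw [real_inner_euclideanSpace]
  refine Finset.sum_congr rfl fun k _ => ?_
  simp
  ring

theorem realModule_eq_toEuclideanLin (g : G) (v : EuclideanSpace ℂ (Fin N)) :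
    realModule G g v = Matrix.toEuclideanLin (g : Matrix (Fin N) (Fin N) ℂ) v := rfl

theorem inner_realModule (g : G) (u v : EuclideanSpace ℂ (Fin N)) :
    ⟪realModule G g u, realModule G g v⟫_ℝ = ⟪u, v⟫_ℝ := by
  have hg : (g : Matrix (Fin N) (Fin N) ℂ).conjTranspose * (g : Matrix (Fin N) (Fin N) ℂ) = 1 :=
    Matrix.mem_unitaryGroup_iff'.1 g.1.2
  rw [real_inner_euclideanSpace_eq_re, real_inner_euclideanSpace_eq_re, realModule_eq_toEuclideanLin,
    realModule_eq_toEuclideanLin, ← LinearMap.adjoint_inner_right,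
    ← Matrix.toEuclideanLin_conjTranspose_eq_adjoint, ← LinearMap.comp_apply]
  congr 2
  ext i
  simp [Matrix.toEuclideanLin, hg, Matrix.mulVec_mulVec]

theorem continuous_realModule (v : EuclideanSpace ℂ (Fin N)) :
    Continuous fun g : G => realModule G g v := by
  have h : Continuous fun g : G => (g : Matrix (Fin N) (Fin N) ℂ) :=
    continuous_subtype_val.comp continuous_subtype_val
  refine (PiLp.continuous_toLp 2 _).comp
    (f := fun g : G => (g : Matrix (Fin N) (Fin N) ℂ).mulVec v.ofLp) ?_
  exact h.matrix_mulVec continuous_const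

theorem dense_isPrincipalPoint (hG : IsCompact (G : Set (Matrix.unitaryGroup (Fin N) ℂ))) :
    Dense {p | IsPrincipalPoint G p} := by
  have : CompactSpace G := isCompact_iff_compactSpace.1 hG
  refine dense_subconjugate_isotropy (ρ := realModule G) inner_realModule fun p q => ?_
  obtain ⟨g, -, hg⟩ := isCompact_univ.exists_isMaxOn (Set.univ_nonempty (α := G))
    (f := fun h : G => ⟪p, realModule G h q⟫_ℝ)
    (continuous_const.inner (continuous_realModule q)).continuousOn
  exact ⟨g, fun h => hg (Set.mem_univ h)⟩

/-- The gradient of an invariant quadratic form is orthogonal to the orbits. -/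
theorem inner_tangentVectors_orbitOf {A : EuclideanSpace ℂ (Fin N) →ₗ[ℝ] EuclideanSpace ℂ (Fin N)}
    (hA : A.IsSymmetric) (hAG : ∀ g v, A (realModule G g v) = realModule G g (A v))
    {p v : EuclideanSpace ℂ (Fin N)} (hv : v ∈ tangentVectors (orbitOf G p) p) :
    ⟪A p, v⟫_ℝ = 0 := by
  obtain ⟨γ, -, hγ, rfl, hd⟩ := hv
  have hconst : (fun t => ⟪A (γ t), γ t⟫_ℝ) = fun _ => ⟪A (γ 0), γ 0⟫_ℝ := by
    funext t
    obtain ⟨g, hg⟩ := hγ t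
    simp only at hg
    rw [← hg, hAG, inner_realModule]
  have h₁ := ((LinearMap.toContinuousLinearMap A).hasFDerivAt.comp_hasDerivAt (0 : ℝ) hd).inner ℝ hd
  have h₂ : HasDerivAt (fun t => ⟪A (γ t), γ t⟫_ℝ) 0 0 := by
    rw [hconst]
    exact hasDerivAt_const _ _
  have h₃ := h₁.unique h₂
  simp only [Function.comp_apply, LinearMap.coe_toContinuousLinearMap'] at h₃
  rw [hA v, real_inner_comm] at h₃
  linarith [real_inner_comm (A (γ 0)) v]

/-- Invariant quadratic forms Poisson-commute if the action is coisotropic. -/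
theorem inner_I_smul_eq_zero (hG : IsCompact (G : Set (Matrix.unitaryGroup (Fin N) ℂ)))
    (hco : IsCoisotropicAction G)
    {A B : EuclideanSpace ℂ (Fin N) →ₗ[ℝ] EuclideanSpace ℂ (Fin N)}
    (hA : A.IsSymmetric) (hB : B.IsSymmetric)
    (hAG : ∀ g v, A (realModule G g v) = realModule G g (A v))
    (hBG : ∀ g v, B (realModule G g v) = realModule G g (B v)) (p : EuclideanSpace ℂ (Fin N)) :
    ⟪B p, Complex.I • A p⟫_ℝ = 0 := by
  have hcA : Continuous A := A.continuous_of_finiteDimensional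
  have hcB : Continuous B := B.continuous_of_finiteDimensional
  refine congrFun (Continuous.ext_on (dense_isPrincipalPoint hG)
    (hcB.inner (hcA.const_smul Complex.I)) continuous_const fun p hp => ?_) p
  -- Multiplying by `i` turns Euclidean normals into `ω`-orthogonal vectors, so `i A p` is tangent
  -- by coisotropy.
  refine inner_tangentVectors_orbitOf hB hBG (hco p hp p ⟨1, by simp⟩ fun v hv => ?_)
  rw [stdSymplecticForm_eq_inner, Pi.smul_apply, smul_smul, Complex.I_mul_I, neg_one_smul, inner_neg_left,
    inner_tangentVectors_orbitOf hA hAG hv, neg_zero]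

theorem real_inner_I_smul_left (u v : EuclideanSpace ℂ (Fin N)) :
    ⟪Complex.I • u, v⟫_ℝ = -⟪u, Complex.I • v⟫_ℝ := by
  simp only [real_inner_euclideanSpace, ← Finset.sum_neg_distrib]
  refine Finset.sum_congr rfl fun k _ => ?_
  simp

theorem apply_I_smul_apply_comm (hG : IsCompact (G : Set (Matrix.unitaryGroup (Fin N) ℂ)))
    (hco : IsCoisotropicAction G)
    {A B : EuclideanSpace ℂ (Fin N) →ₗ[ℝ] EuclideanSpace ℂ (Fin N)}
    (hA : A.IsSymmetric) (hB : B.IsSymmetric)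
    (hAG : ∀ g v, A (realModule G g v) = realModule G g (A v))
    (hBG : ∀ g v, B (realModule G g v) = realModule G g (B v)) (v : EuclideanSpace ℂ (Fin N)) :
    B (Complex.I • A v) = A (Complex.I • B v) := by
  refine ext_inner_left ℝ fun u => ?_
  -- Polarisation of the vanishing quadratic form.
  have h := inner_I_smul_eq_zero hG hco hA hB hAG hBG (u + v)
  rw [map_add, map_add, smul_add, inner_add_left, inner_add_right, inner_add_right,
    inner_I_smul_eq_zero hG hco hA hB hAG hBG u, inner_I_smul_eq_zero hG hco hA hB hAG hBG v] at h
  rw [← hA, ← hB]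
  have h' := real_inner_I_smul_left (B v) (A u)
  rw [real_inner_comm] at h'
  linarith

theorem apply_apply_comm (hG : IsCompact (G : Set (Matrix.unitaryGroup (Fin N) ℂ)))
    (hco : IsCoisotropicAction G)
    {A B : EuclideanSpace ℂ (Fin N) →ₗ[ℝ] EuclideanSpace ℂ (Fin N)}
    (hA : A.IsSymmetric) (hB : B.IsSymmetric)
    (hAG : ∀ g v, A (realModule G g v) = realModule G g (A v))
    (hBG : ∀ g v, B (realModule G g v) = realModule G g (B v)) (v : EuclideanSpace ℂ (Fin N)) :
    A (B v) = B (A v) := by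
  have hI : ∀ {C : EuclideanSpace ℂ (Fin N) →ₗ[ℝ] EuclideanSpace ℂ (Fin N)}, C.IsSymmetric →
      (∀ g v, C (realModule G g v) = realModule G g (C v)) →
      ∀ v, C (Complex.I • v) = Complex.I • C v := fun hC hCG v =>
    apply_I_smul_apply_comm hG hco (A := LinearMap.id) (fun _ _ => rfl) hC (fun _ _ => rfl) hCG v
  have h := apply_I_smul_apply_comm hG hco hA hB hAG hBG v
  rw [hI hA hAG, hI hB hBG] at h
  exact (smul_right_injective _ Complex.I_ne_zero h).symm

end Unitary

theorem subrepresentation_le_of_equiv {N : ℕ} {G : Subgroup (Matrix.unitaryGroup (Fin N) ℂ)}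
    (hG : IsCompact (G : Set (Matrix.unitaryGroup (Fin N) ℂ))) (hco : IsCoisotropicAction G)
    {E₁ E₂ : Subrepresentation (realModule G)}
    (e : Representation.Equiv E₁.toRepresentation E₂.toRepresentation) :
    E₁.toSubmodule ≤ E₂.toSubmodule :=
  le_of_equivariant_of_commute (ρ := realModule G) inner_realModule
    (fun _ _ hA hB hAG hBG => apply_apply_comm hG hco hA hB hAG hBG)
    (fun g _ hv => E₁.apply_mem_toSubmodule g hv) (fun g _ hv => E₂.apply_mem_toSubmodule g hv)
    e.toLinearEquiv.toLinearMap e.toLinearEquiv.injective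
    fun g v => congrArg Subtype.val (e.toIntertwiningMap.isIntertwining E₁.toRepresentation E₂.toRepresentation g v)

theorem proposition1p6 (N : ℕ) (G : Subgroup (Matrix.unitaryGroup (Fin N) ℂ))
    (hG : IsCompact (G : Set (Matrix.unitaryGroup (Fin N) ℂ)))
    (hco : IsCoisotropicAction G)
    (E₁ E₂ : Subrepresentation (realModule G))
    (hE : Nonempty (Representation.Equiv E₁.toRepresentation E₂.toRepresentation)) :
    E₁ = E₂ := by
  obtain ⟨e⟩ := hE
  exact Subrepresentation.toSubmodule_injective (le_antisymm
    (subrepresentation_le_of_equiv hG hco e) (subrepresentation_le_of_equiv hG hco e.symm))
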